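/- Let $0 < s \leq 1$. For a unit vector $e \in S^1 \subset \mathbb{R}^2$ let $\rho_e(x) = x \cdot e$. A family $\mathcal{L}$ of non-degenerate line segments in $\mathbb{R}^2$, all perpendicular to $e$, is called $s$-dimensional if $\mathcal{H}^s\big(\rho_e(\bigcup \mathcal{L})\big) > 0$, where $\mathcal{H}^s$ is the $s$-dimensional Hausdorff (outer) measure; no measurability of $\bigcup \mathcal{L}$ or $\rho_e(\bigcup \mathcal{L})$ is required. Let $K \subset \mathbb{R}^2$ be compact, and let $E_0 \subset S^1$ be a set, not assumed measurable, with Hausdorff dimension $\dim E_0 > 1 - s$. Suppose that for every $e \in E_0$ there is an $s$-dimensional family $\mathcal{L}_e$ of line segments perpendicular to $e$ with $\bigcup \mathcal{L}_e \subset K$. Then $K$ has positive Lebesgue measure: $\mathcal{L}^2(K) > 0$. -/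

import Mathlib

open MeasureTheory

/-- `ℓ` is a (closed, non-degenerate) line segment in the plane which is perpendicular to `e`. -/
def IsPerpSegment (e : EuclideanSpace ℝ (Fin 2)) (ℓ : Set (EuclideanSpace ℝ (Fin 2))) : Prop :=
  ∃ x y : EuclideanSpace ℝ (Fin 2), x ≠ y ∧ inner ℝ (y - x) e = 0 ∧ ℓ = segment ℝ x y

/-- The orthogonal projection `ρ_e(x) = x · e`, as a real-valued map. -/
noncomputable def lineProj (e x : EuclideanSpace ℝ (Fin 2)) : ℝ := inner ℝ x e

/-- `F` is an `s`-dimensional family of line segments perpendicular to `e`: all its members are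
line segments perpendicular to `e`, and the projection `ρ_e` of their union has positive
`s`-dimensional Hausdorff measure. No measurability is required (for a non-measurable set,
the value of `μH[s]` is that of the Hausdorff outer measure). -/
def IsDimFamily (s : ℝ) (e : EuclideanSpace ℝ (Fin 2))
    (F : Set (Set (EuclideanSpace ℝ (Fin 2)))) : Prop :=
  (∀ ℓ ∈ F, IsPerpSegment e ℓ) ∧ 0 < Measure.hausdorffMeasure s (lineProj e '' ⋃₀ F)

/-!
In slope-intercept coordinates a segment perpendicular to `e` is a part of a line `y = a x + b` with
`a = -e₀ / e₁` and `b = (x · e) / e₁`, and the map from slopes back to unit normals is `C¹`. So there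
is a set `A` of slopes with `dimH A > 1 - s` such that, for each `a ∈ A`, a set of intercepts `b` of
positive `s`-dimensional measure gives lines containing a non-degenerate segment in the compact set
`K`. By countable stability one may assume that all these segments lie over one interval `[u, v]`,
and that the Hausdorff contents of the sets of intercepts are bounded below.

Choose `t < dimH A` with `s + t > 1` and let `δ = 2 ^ (-n)`. A discrete Frostman lemma
(`exists_discrete_frostman_measure`) needs no measurability: it gives finitely supported measures, of
mass bounded below, on `A` and on the sets of intercepts, which have dimension `t` and `s` down to
scale `δ`. They define a finite weighted family of `δ`-tubes inside the `δ`-neighbourhood of `K`. Two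
tubes of slopes `a`, `a'` with `|a - a'| ∼ 2 ^ (-k)` meet in area `≲ δ² 2 ^ k`, and only if
`|b - b'| ≲ 2 ^ (-k)` (`volume_tube_inter_le_sum`), so the total overlap is at most
`δ² ∑ k, 2 ^ (k * (1 - s - t)) ≲ δ²`. Since the total area of the tubes, with weights, is `≳ δ`, the
Cauchy–Schwarz inequality (`sq_sum_measure_le`) bounds the area of the `δ`-neighbourhood of `K` below
independently of `δ` (`le_volume_cthickening`). Letting `δ → 0` gives the result, as `K` is compact.
-/

open scoped ENNReal Topology Pointwise

/-! ### Dyadic intervals and Hausdorff content -/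

/-- The half-open dyadic interval `[j / 2 ^ k, (j + 1) / 2 ^ k)` of generation `k`, encoded through
the floor function. -/
def dyadicInterval (k : ℕ) (j : ℤ) : Set ℝ := {x | ⌊(2 : ℝ) ^ k * x⌋ = j}

lemma mem_dyadicInterval {k : ℕ} {j : ℤ} {x : ℝ} :
    x ∈ dyadicInterval k j ↔ ⌊(2 : ℝ) ^ k * x⌋ = j := Iff.rfl

lemma ediam_dyadicInterval_le (k : ℕ) (j : ℤ) :
    Metric.ediam (dyadicInterval k j) ≤ (1 / 2) ^ k := by
  refine Metric.ediam_le fun x hx y hy => ?_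
  have h1 : |(2 : ℝ) ^ k * x - 2 ^ k * y| < 1 :=
    Int.abs_sub_lt_one_of_floor_eq_floor (hx.trans hy.symm)
  have h2 : (0 : ℝ) < 2 ^ k := by positivity
  rw [← mul_sub, abs_mul, abs_of_pos h2] at h1
  have h3 : dist x y ≤ (1 / 2) ^ k := by
    rw [Real.dist_eq, one_div, inv_pow, ← one_div, le_div_iff₀ h2]
    linarith
  have h4 : ((1 / 2 : ℝ≥0∞)) ^ k = ENNReal.ofReal ((1 / 2) ^ k) := by
    rw [ENNReal.ofReal_pow (by norm_num), ENNReal.ofReal_div_of_pos (by norm_num)]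
    simp
  rw [edist_dist, h4]
  exact ENNReal.ofReal_le_ofReal h3

lemma floor_two_pow_mul_eq (k : ℕ) (x : ℝ) :
    ⌊(2 : ℝ) ^ k * x⌋ = ⌊(2 : ℝ) ^ (k + 1) * x⌋ / 2 := by
  have h := Int.floor_le ((2 : ℝ) ^ (k + 1) * x)
  have h' := Int.lt_floor_add_one ((2 : ℝ) ^ (k + 1) * x)
  set m := ⌊(2 : ℝ) ^ (k + 1) * x⌋
  have e : (2 : ℝ) ^ (k + 1) * x = 2 * (2 ^ k * x) := by ring
  rw [e] at h h'
  have h1 : 2 * (m / 2) ≤ m := by omega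
  have h2 : m + 1 ≤ 2 * (m / 2) + 2 := by omega
  have h1' : (2 : ℝ) * ((m / 2 : ℤ) : ℝ) ≤ m := by exact_mod_cast h1
  have h2' : (m : ℝ) + 1 ≤ 2 * ((m / 2 : ℤ) : ℝ) + 2 := by exact_mod_cast h2
  rw [Int.floor_eq_iff]
  constructor <;> linarith

lemma floor_eq_of_floor_eq {k k' : ℕ} (h : k ≤ k') {x y : ℝ}
    (hxy : ⌊(2 : ℝ) ^ k' * x⌋ = ⌊(2 : ℝ) ^ k' * y⌋) : ⌊(2 : ℝ) ^ k * x⌋ = ⌊(2 : ℝ) ^ k * y⌋ := by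
  induction k', h using Nat.le_induction with
  | base => exact hxy
  | succ m _ ih => exact ih (by rw [floor_two_pow_mul_eq m x, floor_two_pow_mul_eq m y, hxy])

lemma dyadicInterval_eq_union (k : ℕ) (j : ℤ) :
    dyadicInterval k j = dyadicInterval (k + 1) (2 * j) ∪ dyadicInterval (k + 1) (2 * j + 1) := by
  ext x
  simp only [Set.mem_union, mem_dyadicInterval, floor_two_pow_mul_eq k x]
  omega

/-- The `t`-dimensional Hausdorff content, as an outer measure. It is only used for `t > 0`; that
hypothesis makes the gauge vanish on the empty set. -/
noncomputable def hausdorffContent (t : ℝ) (ht : 0 < t) : OuterMeasure ℝ :=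
  OuterMeasure.ofFunction (fun U => Metric.ediam U ^ t) (by simp [ht])

lemma hausdorffContent_dyadicInterval_le {t : ℝ} (ht : 0 < t) (k : ℕ) (j : ℤ) :
    hausdorffContent t ht (dyadicInterval k j) ≤ ((1 / 2 : ℝ≥0∞) ^ t) ^ k := by
  refine (OuterMeasure.ofFunction_le _).trans ?_
  rw [← ENNReal.rpow_natCast, ← ENNReal.rpow_mul, mul_comm t, ENNReal.rpow_mul,
    ENNReal.rpow_natCast]
  exact ENNReal.rpow_le_rpow (ediam_dyadicInterval_le k j) ht.le

lemma hausdorffContent_pos {t : ℝ} (ht : 0 < t) {E : Set ℝ}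
    (hE : 0 < Measure.hausdorffMeasure t E) : 0 < hausdorffContent t ht E := by
  by_contra h0
  replace h0 : hausdorffContent t ht E = 0 := by simpa using h0
  refine hE.ne' ?_
  rw [Measure.hausdorffMeasure_apply]
  refine le_antisymm (iSup₂_le fun r hr => ?_) bot_le
  refine le_of_forall_pos_le_add fun ε hε => ?_
  rw [zero_add]
  have hpos : 0 < min ε (r ^ t) := lt_min hε (by
    rcases eq_or_ne r ⊤ with rfl | hr'
    · simp [ht]
    · exact ENNReal.rpow_pos hr hr')
  rw [hausdorffContent, OuterMeasure.ofFunction_apply] at h0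
  obtain ⟨U, hU⟩ := iInf_lt_iff.1 (h0.trans_lt hpos)
  obtain ⟨hEU, hU⟩ := iInf_lt_iff.1 hU
  refine iInf_le_of_le U (iInf_le_of_le hEU (iInf_le_of_le (fun n => ?_) ?_))
  · have h1 : Metric.ediam (U n) ^ t ≤ r ^ t :=
      (ENNReal.le_tsum n).trans (hU.le.trans (min_le_right _ _))
    exact (ENNReal.rpow_le_rpow_iff ht).1 h1
  · refine le_trans (b := ∑' n, Metric.ediam (U n) ^ t) ?_ (hU.le.trans (min_le_left _ _))
    exact ENNReal.tsum_le_tsum fun n => iSup_le fun _ => le_rfl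

/-! ### A discrete Frostman lemma -/

/-- Frostman's lemma on finitely many scales, for an arbitrary set `E`: if the outer measure `H` of
every dyadic interval of generation `k` is at most `g k`, then each piece `E ∩ dyadicInterval k j`
carries a finitely supported measure of mass at least its `H`-measure which satisfies the same upper
bounds down to generation `k + d`. Adding the measures of the two halves and shrinking the sum when
it is too heavy for `g k` gives the inductive step. -/
theorem exists_discrete_frostman_measure (H : OuterMeasure ℝ) (g : ℕ → ℝ≥0∞)
    (hg : ∀ k j, H (dyadicInterval k j) ≤ g k) (hfin : ∀ k, g k ≠ ⊤) (E : Set ℝ) (d : ℕ) :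
    ∀ (k : ℕ) (j : ℤ), ∃ (μ : Measure ℝ) (P : Finset ℝ), (P : Set ℝ) ⊆ E ∩ dyadicInterval k j ∧
      μ (P : Set ℝ)ᶜ = 0 ∧ H (E ∩ dyadicInterval k j) ≤ μ Set.univ ∧
      ∀ k', k ≤ k' → k' ≤ k + d → ∀ j', μ (dyadicInterval k' j') ≤ g k' := by
  classical
  induction d with
  | zero =>
    intro k j
    rcases (E ∩ dyadicInterval k j).eq_empty_or_nonempty with h | ⟨x, hx⟩
    · exact ⟨0, ∅, by simp, by simp, by simp [h], by simp⟩
    · refine ⟨g k • Measure.dirac x, {x}, by simpa using hx, ?_, ?_, ?_⟩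
      · simp
      · simpa using (H.mono Set.inter_subset_right).trans (hg k j)
      · intro k' h1 h2 j'
        obtain rfl : k' = k := by omega
        rw [Measure.smul_apply, smul_eq_mul]
        exact mul_le_of_le_one_right' prob_le_one
  | succ d ih =>
    intro k j
    obtain ⟨μ₀, P₀, hP₀, hc₀, hm₀, hb₀⟩ := ih (k + 1) (2 * j)
    obtain ⟨μ₁, P₁, hP₁, hc₁, hm₁, hb₁⟩ := ih (k + 1) (2 * j + 1)
    set ν := μ₀ + μ₁ with hν
    have hsub : ((P₀ ∪ P₁ : Finset ℝ) : Set ℝ) ⊆ E ∩ dyadicInterval k j := by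
      rw [dyadicInterval_eq_union, Finset.coe_union, Set.inter_union_distrib_left]
      exact Set.union_subset_union hP₀ hP₁
    have hc : ν ((P₀ ∪ P₁ : Finset ℝ) : Set ℝ)ᶜ = 0 := by
      rw [hν, Measure.add_apply, Finset.coe_union]
      simp only [add_eq_zero]
      exact ⟨measure_mono_null (Set.compl_subset_compl.2 Set.subset_union_left) hc₀,
        measure_mono_null (Set.compl_subset_compl.2 Set.subset_union_right) hc₁⟩
    have hm : H (E ∩ dyadicInterval k j) ≤ ν Set.univ := by
      rw [dyadicInterval_eq_union, Set.inter_union_distrib_left, hν, Measure.add_apply]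
      exact (measure_union_le _ _).trans (add_le_add hm₀ hm₁)
    have hb : ∀ k', k + 1 ≤ k' → k' ≤ k + (d + 1) → ∀ j', ν (dyadicInterval k' j') ≤ g k' := by
      intro k' h1 h2 j'
      -- a dyadic interval of a later generation meets at most one of the two halves
      have key : Disjoint (dyadicInterval k' j') (P₀ : Set ℝ) ∨
          Disjoint (dyadicInterval k' j') (P₁ : Set ℝ) := by
        by_contra! hcon
        obtain ⟨⟨x, hx, hx'⟩, ⟨y, hy, hy'⟩⟩ :=
          hcon.imp Set.not_disjoint_iff.1 Set.not_disjoint_iff.1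
        have e1 := (hP₀ hx').2
        have e2 := (hP₁ hy').2
        rw [mem_dyadicInterval] at hx hy e1 e2
        have := floor_eq_of_floor_eq h1 (hx.trans hy.symm)
        omega
      rw [hν, Measure.add_apply]
      rcases key with h | h
      · rw [measure_mono_null h.subset_compl_right hc₀, zero_add]
        exact hb₁ k' h1 (by omega) j'
      · rw [measure_mono_null h.subset_compl_right hc₁, add_zero]
        exact hb₀ k' h1 (by omega) j'
    by_cases hle : ν Set.univ ≤ g k
    · refine ⟨ν, P₀ ∪ P₁, hsub, hc, hm, fun k' h1 h2 j' => ?_⟩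
      rcases h1.eq_or_lt with rfl | h1
      · exact (measure_mono (Set.subset_univ _)).trans hle
      · exact hb k' h1 h2 j'
    · push Not at hle
      have hfinν : ν Set.univ ≠ ⊤ := by
        have aux : ∀ (μ : Measure ℝ) (P : Finset ℝ) (i : ℤ),
            (P : Set ℝ) ⊆ E ∩ dyadicInterval (k + 1) i → μ (P : Set ℝ)ᶜ = 0 →
            μ (dyadicInterval (k + 1) i) ≤ g (k + 1) → μ Set.univ ≠ ⊤ := by
          intro μ P i h1 h2 h3
          refine ne_top_of_le_ne_top (hfin (k + 1)) (le_trans ?_ h3)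
          rw [← Set.union_compl_self (P : Set ℝ)]
          refine (measure_union_le _ _).trans ?_
          rw [h2, add_zero]
          exact measure_mono (h1.trans Set.inter_subset_right)
        rw [hν, Measure.add_apply]
        exact ENNReal.add_ne_top.2 ⟨aux μ₀ P₀ _ hP₀ hc₀ (hb₀ _ le_rfl (by omega) _),
          aux μ₁ P₁ _ hP₁ hc₁ (hb₁ _ le_rfl (by omega) _)⟩
      have hν0 : ν Set.univ ≠ 0 := (bot_le.trans_lt hle).ne'
      set c := g k / ν Set.univ with hcdef
      have hc1 : c ≤ 1 := ENNReal.div_le_of_le_mul (by simpa using hle.le)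
      have htot : (c • ν) Set.univ = g k := by
        rw [Measure.smul_apply, smul_eq_mul, hcdef, ENNReal.div_mul_cancel hν0 hfinν]
      refine ⟨c • ν, P₀ ∪ P₁, hsub, ?_, ?_, fun k' h1 h2 j' => ?_⟩
      · rw [Measure.smul_apply, hc, smul_zero]
      · rw [htot]
        exact (H.mono Set.inter_subset_right).trans (hg k j)
      · rcases h1.eq_or_lt with rfl | h1
        · exact (measure_mono (Set.subset_univ _)).trans htot.le
        · rw [Measure.smul_apply, smul_eq_mul]
          exact (mul_le_of_le_one_left' hc1).trans (hb k' h1 h2 j')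

/-- A bound on all dyadic intervals of one generation gives a bound on all intervals of comparable
length. -/
lemma measure_setOf_abs_sub_le {μ : Measure ℝ} {k : ℕ} {M : ℝ≥0∞}
    (h : ∀ j, μ (dyadicInterval k j) ≤ M) (x : ℝ) (N : ℕ) :
    μ {y | |x - y| * 2 ^ k ≤ N} ≤ (2 * N + 1 : ℕ) * M := by
  set f := ⌊(2 : ℝ) ^ k * x⌋ with hf
  have hsub : {y : ℝ | |x - y| * 2 ^ k ≤ N} ⊆
      ⋃ i ∈ Finset.Icc (f - N) (f + N), dyadicInterval k i := by
    intro y hy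
    have hy' : |(2 : ℝ) ^ k * x - 2 ^ k * y| ≤ N := by
      rw [← mul_sub, abs_mul, abs_of_pos (by positivity : (0 : ℝ) < 2 ^ k), mul_comm]
      exact hy
    rw [abs_le] at hy'
    simp only [Set.mem_iUnion, Finset.mem_Icc, exists_prop]
    refine ⟨⌊(2 : ℝ) ^ k * y⌋, ⟨?_, ?_⟩, rfl⟩
    · rw [hf, ← Int.floor_sub_natCast]
      exact Int.floor_le_floor (by linarith)
    · rw [hf, ← Int.floor_add_natCast]
      exact Int.floor_le_floor (by linarith)
  calc μ {y : ℝ | |x - y| * 2 ^ k ≤ N}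
      ≤ μ (⋃ i ∈ Finset.Icc (f - N) (f + N), dyadicInterval k i) := measure_mono hsub
    _ ≤ ∑ i ∈ Finset.Icc (f - N) (f + N), μ (dyadicInterval k i) :=
        measure_biUnion_finset_le _ _
    _ ≤ ∑ i ∈ Finset.Icc (f - (N : ℤ)) (f + N), M := Finset.sum_le_sum fun i _ => h i
    _ = (2 * N + 1 : ℕ) * M := by
        rw [Finset.sum_const, Int.card_Icc, nsmul_eq_mul]
        congr 2
        omega

/-! ### The `L²` argument -/

/-- Cauchy–Schwarz for a weighted sum of indicators of sets contained in `U`. -/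
theorem sq_sum_measure_le {α ι : Type*} [MeasurableSpace α] (μ : Measure α) (S : Finset ι)
    (w : ι → ℝ≥0∞) (T : ι → Set α) (hT : ∀ i, MeasurableSet (T i)) {U : Set α}
    (hU : MeasurableSet U) (hTU : ∀ i ∈ S, T i ⊆ U) :
    (∑ i ∈ S, w i * μ (T i)) ^ 2 ≤
      μ U * ∑ i ∈ S, w i * ∑ j ∈ S, w j * μ (T i ∩ T j) := by
  set f : α → ℝ≥0∞ := fun p => ∑ i ∈ S, w i * (T i).indicator 1 p with hf
  have hmeas : ∀ i, Measurable ((T i).indicator (1 : α → ℝ≥0∞)) := fun i =>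
    measurable_one.indicator (hT i)
  have hfm : Measurable f :=
    Finset.measurable_sum _ fun i _ => (hmeas i).const_mul _
  have h1 : ∑ i ∈ S, w i * μ (T i) = ∫⁻ p, (f * U.indicator (1 : α → ℝ≥0∞)) p ∂μ := by
    have e : ∀ p, (f * U.indicator (1 : α → ℝ≥0∞)) p = f p := by
      intro p
      by_cases hp : p ∈ U
      · simp [hp]
      · have : f p = 0 := Finset.sum_eq_zero fun i hi => by
          rw [Set.indicator_of_notMem (fun h => hp (hTU i hi h)), mul_zero]
        simp [this]
    simp_rw [e, hf]
    rw [lintegral_finsetSum _ fun i _ => (hmeas i).const_mul _]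
    refine Finset.sum_congr rfl fun i _ => ?_
    rw [lintegral_const_mul _ (hmeas i), lintegral_indicator_one (hT i)]
  have h2 : ∫⁻ p, f p ^ (2 : ℝ) ∂μ = ∑ i ∈ S, w i * ∑ j ∈ S, w j * μ (T i ∩ T j) := by
    have e : ∀ p, f p ^ (2 : ℝ) =
        ∑ i ∈ S, w i * ∑ j ∈ S, w j * (T i ∩ T j).indicator 1 p := by
      intro p
      rw [ENNReal.rpow_two, sq, hf]
      simp only [Finset.sum_mul]
      refine Finset.sum_congr rfl fun i _ => ?_
      rw [mul_assoc, Finset.mul_sum]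
      congr 1
      refine Finset.sum_congr rfl fun j _ => ?_
      rw [Set.inter_indicator_one, Pi.mul_apply]
      ring
    have hmeas' : ∀ i j, Measurable ((T i ∩ T j).indicator (1 : α → ℝ≥0∞)) := fun i j =>
      measurable_one.indicator ((hT i).inter (hT j))
    simp_rw [e]
    rw [lintegral_finsetSum _ fun i _ =>
      (Finset.measurable_sum _ fun j _ => (hmeas' i j).const_mul _).const_mul _]
    refine Finset.sum_congr rfl fun i _ => ?_
    rw [lintegral_const_mul _ (Finset.measurable_sum _ fun j _ => (hmeas' i j).const_mul _),
      lintegral_finsetSum _ fun j _ => (hmeas' i j).const_mul _]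
    congr 1
    refine Finset.sum_congr rfl fun j _ => ?_
    rw [lintegral_const_mul _ (hmeas' i j), lintegral_indicator_one ((hT i).inter (hT j))]
  have h3 : ∫⁻ p, (U.indicator (1 : α → ℝ≥0∞) p) ^ (2 : ℝ) ∂μ = μ U := by
    rw [← lintegral_indicator_one hU]
    congr 1
    ext p
    by_cases hp : p ∈ U <;> simp [hp]
  have h4 := ENNReal.lintegral_mul_le_Lp_mul_Lq μ Real.HolderConjugate.two_two hfm.aemeasurable
    (measurable_one.indicator hU : Measurable (U.indicator (1 : α → ℝ≥0∞))).aemeasurable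
  rw [← h1, h2, h3, ← ENNReal.mul_rpow_of_nonneg _ _ (by norm_num : (0 : ℝ) ≤ 1 / 2)] at h4
  calc (∑ i ∈ S, w i * μ (T i)) ^ 2
      ≤ (((∑ i ∈ S, w i * ∑ j ∈ S, w j * μ (T i ∩ T j)) * μ U) ^ (1 / 2 : ℝ)) ^ 2 := by gcongr
    _ = _ := by
        rw [← ENNReal.rpow_natCast, ← ENNReal.rpow_mul]
        norm_num [mul_comm]

/-! ### Tubes -/

/-- The vertical `δ`-neighbourhood of the part of the line `y = a x + b` over `[u, v]`. -/
def tube (u v δ : ℝ) (a b : ℝ) : Set (ℝ × ℝ) :=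
  {p | p.1 ∈ Set.Icc u v ∧ |p.2 - (a * p.1 + b)| ≤ δ}

lemma measurableSet_tube (u v δ a b : ℝ) : MeasurableSet (tube u v δ a b) := by
  have h1 : IsClosed {p : ℝ × ℝ | p.1 ∈ Set.Icc u v} := isClosed_Icc.preimage continuous_fst
  have h2 : IsClosed {p : ℝ × ℝ | |p.2 - (a * p.1 + b)| ≤ δ} :=
    isClosed_le (by fun_prop) continuous_const
  exact (h1.inter h2).measurableSet

lemma setOf_abs_sub_le_eq_Icc (c δ : ℝ) : {y : ℝ | |y - c| ≤ δ} = Set.Icc (c - δ) (c + δ) := by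
  ext y
  simp only [Set.mem_ofPred_eq, abs_le, Set.mem_Icc]
  constructor <;> rintro ⟨h1, h2⟩ <;> constructor <;> linarith

lemma volume_tube (u v δ a b : ℝ) :
    volume (tube u v δ a b) = ENNReal.ofReal (2 * δ) * ENNReal.ofReal (v - u) := by
  rw [Measure.volume_eq_prod, Measure.prod_apply (measurableSet_tube u v δ a b)]
  have e : ∀ x, volume (Prod.mk x ⁻¹' tube u v δ a b) =
      (Set.Icc u v).indicator (fun _ => ENNReal.ofReal (2 * δ)) x := by
    intro x
    by_cases hx : x ∈ Set.Icc u v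
    · have : Prod.mk x ⁻¹' tube u v δ a b = {y | |y - (a * x + b)| ≤ δ} := by
        ext y
        exact ⟨fun h => h.2, fun h => ⟨hx, h⟩⟩
      rw [this, setOf_abs_sub_le_eq_Icc, Real.volume_Icc, Set.indicator_of_mem hx]
      congr 1
      ring
    · have : Prod.mk x ⁻¹' tube u v δ a b = ∅ :=
        Set.eq_empty_of_forall_notMem fun y h => hx h.1
      rw [this, Set.indicator_of_notMem hx, measure_empty]
  simp_rw [e]
  rw [lintegral_indicator measurableSet_Icc, setLIntegral_const, Real.volume_Icc]

lemma volume_tube_inter_le {u v δ a b a' b' : ℝ} (ha : a ≠ a') :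
    volume (tube u v δ a b ∩ tube u v δ a' b') ≤
      ENNReal.ofReal (2 * δ) * ENNReal.ofReal (4 * δ / |a - a'|) := by
  have hd : 0 < |a - a'| := abs_pos.2 (sub_ne_zero.2 ha)
  set c := -(b - b') / (a - a') with hc
  set r := 2 * δ / |a - a'| with hr
  rw [Measure.volume_eq_prod, Measure.prod_apply
    ((measurableSet_tube u v δ a b).inter (measurableSet_tube u v δ a' b'))]
  have e : ∀ x, volume (Prod.mk x ⁻¹' (tube u v δ a b ∩ tube u v δ a' b')) ≤
      (Set.Icc (c - r) (c + r)).indicator (fun _ => ENNReal.ofReal (2 * δ)) x := by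
    intro x
    by_cases hx : x ∈ Set.Icc (c - r) (c + r)
    · rw [Set.indicator_of_mem hx]
      have : Prod.mk x ⁻¹' (tube u v δ a b ∩ tube u v δ a' b') ⊆ {y | |y - (a * x + b)| ≤ δ} :=
        fun y h => h.1.2
      refine (measure_mono this).trans ?_
      rw [setOf_abs_sub_le_eq_Icc, Real.volume_Icc]
      exact ENNReal.ofReal_le_ofReal (by linarith)
    · have : Prod.mk x ⁻¹' (tube u v δ a b ∩ tube u v δ a' b') = ∅ := by
        refine Set.eq_empty_of_forall_notMem fun y h => hx ?_
        have h1 : |y - (a * x + b)| ≤ δ := h.1.2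
        have h2 : |y - (a' * x + b')| ≤ δ := h.2.2
        rw [← setOf_abs_sub_le_eq_Icc, Set.mem_ofPred_eq, hr, le_div_iff₀ hd, ← abs_mul]
        have h3 : (x - c) * (a - a') = (y - (a' * x + b')) - (y - (a * x + b)) := by
          rw [hc]
          field_simp [sub_ne_zero.2 ha]
          ring
        rw [h3]
        exact (abs_sub _ _).trans (by linarith)
      rw [this, measure_empty]
      exact bot_le
  refine (lintegral_mono e).trans ?_
  rw [lintegral_indicator measurableSet_Icc, setLIntegral_const, Real.volume_Icc]
  gcongr
  rw [hr]
  apply le_of_eq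
  ring

lemma tube_subset_cthickening {K : Set (ℝ × ℝ)} {u v δ a b : ℝ}
    (h : ∀ x ∈ Set.Icc u v, (x, a * x + b) ∈ K) :
    tube u v δ a b ⊆ Metric.cthickening δ K := by
  rintro ⟨x, y⟩ ⟨hx, hy⟩
  refine Metric.mem_cthickening_of_dist_le _ (x, a * x + b) _ _ (h x hx) ?_
  rw [Prod.dist_eq, dist_self, max_eq_right dist_nonneg]
  exact hy

/-- Two tubes which meet over `[u, v] ⊆ [-X, X]` have `|b - b'| ≲ δ + X |a - a'|`, and the measure of
the intersection is `≲ δ² / (δ + |a - a'|)`. Both facts are recorded in one dyadic sum with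
`δ = 2 ^ (-n)`: the term at the scale of `|a - a'|` already dominates. -/
lemma volume_tube_inter_le_sum {u v : ℝ} {X : ℕ} (huv : Set.Icc u v ⊆ Set.Icc (-(X : ℝ)) X) (n : ℕ)
    {a a' : ℝ} (haa : |a - a'| ≤ 1) (b b' : ℝ) :
    volume (tube u v ((1 / 2) ^ n) a b ∩ tube u v ((1 / 2) ^ n) a' b') ≤
      ∑ k ∈ Finset.range (n + 1),
        ENNReal.ofReal ((2 * |v - u| + 16) * ((1 / 2) ^ n) ^ 2) * 2 ^ k *
          ({z : ℝ | |a - z| * 2 ^ k ≤ (1 : ℕ)}.indicator 1 a' *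
            {z : ℝ | |b - z| * 2 ^ k ≤ (X + 2 : ℕ)}.indicator 1 b') := by
  set δ : ℝ := (1 / 2) ^ n with hδ
  have hδ0 : 0 < δ := by positivity
  have hδn : δ * 2 ^ n = 1 := by rw [hδ, ← mul_pow]; norm_num
  rcases (tube u v δ a b ∩ tube u v δ a' b').eq_empty_or_nonempty with hemp | ⟨⟨x, y⟩, h1, h2⟩
  · rw [hemp, measure_empty]
    exact bot_le
  have hb : |b - b'| ≤ 2 * δ + X * |a - a'| := by
    have hx : |x| ≤ X := abs_le.2 (huv h1.1)
    have h1' : |y - (a * x + b)| ≤ δ := h1.2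
    have h2' : |y - (a' * x + b')| ≤ δ := h2.2
    have e : b - b' = ((y - (a' * x + b')) - (y - (a * x + b))) - x * (a - a') := by ring
    rw [e]
    refine (abs_sub _ _).trans ?_
    rw [abs_mul]
    have := abs_sub (y - (a' * x + b')) (y - (a * x + b))
    have := mul_le_mul_of_nonneg_right hx (abs_nonneg (a - a'))
    linarith
  -- it suffices to find the scale `k` of `|a - a'|`
  have suff : ∀ k ≤ n, |a - a'| * 2 ^ k ≤ 1 →
      volume (tube u v δ a b ∩ tube u v δ a' b') ≤
        ENNReal.ofReal ((2 * |v - u| + 16) * δ ^ 2) * 2 ^ k →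
      volume (tube u v δ a b ∩ tube u v δ a' b') ≤
      ∑ k ∈ Finset.range (n + 1), ENNReal.ofReal ((2 * |v - u| + 16) * δ ^ 2) * 2 ^ k *
          ({z : ℝ | |a - z| * 2 ^ k ≤ (1 : ℕ)}.indicator 1 a' *
            {z : ℝ | |b - z| * 2 ^ k ≤ (X + 2 : ℕ)}.indicator 1 b') := by
    intro k hk hak hvol
    have hbk : |b - b'| * 2 ^ k ≤ (X + 2 : ℕ) := by
      have h2k : (2 : ℝ) ^ k ≤ 2 ^ n := pow_le_pow_right₀ (by norm_num) hk
      have h3 : δ * 2 ^ k ≤ 1 := hδn ▸ mul_le_mul_of_nonneg_left h2k hδ0.le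
      have h4 : |b - b'| * 2 ^ k ≤ (2 * δ + X * |a - a'|) * 2 ^ k := by gcongr
      have h5 : (X : ℝ) * (|a - a'| * 2 ^ k) ≤ X * 1 := by gcongr
      push_cast
      linarith
    refine hvol.trans (le_trans ?_ (Finset.single_le_sum (fun _ _ => bot_le)
      (Finset.mem_range.2 (Nat.lt_succ_of_le hk))))
    rw [Set.indicator_of_mem (by simpa using hak), Set.indicator_of_mem (by exact hbk)]
    simp
  have h2k : ∀ k : ℕ, (2 : ℝ≥0∞) ^ k = ENNReal.ofReal (2 ^ k) := fun k => by
    rw [ENNReal.ofReal_pow (by norm_num)]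
    simp
  by_cases hn : |a - a'| * 2 ^ n ≤ 1
  · refine suff n le_rfl hn ?_
    refine (measure_mono Set.inter_subset_left).trans ?_
    rw [volume_tube, h2k, ← ENNReal.ofReal_mul (by positivity), ← ENNReal.ofReal_mul (by positivity)]
    refine ENNReal.ofReal_le_ofReal ?_
    have e : (2 * |v - u| + 16) * δ ^ 2 * 2 ^ n = (2 * |v - u| + 16) * δ := by
      linear_combination (2 * |v - u| + 16) * δ * hδn
    rw [e]
    have := mul_le_mul_of_nonneg_left (le_abs_self (v - u)) hδ0.le
    linarith
  · push Not at hn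
    have hex : ∃ k, 1 < |a - a'| * 2 ^ k := ⟨n, hn⟩
    classical
    obtain ⟨m, hm⟩ : ∃ m, Nat.find hex = m + 1 := by
      refine Nat.exists_eq_succ_of_ne_zero fun h0 => ?_
      have := Nat.find_spec hex
      rw [h0] at this
      linarith
    have hlt := Nat.find_spec hex
    rw [hm] at hlt
    have hmn : m + 1 ≤ n := hm ▸ Nat.find_min' hex hn
    have hle : |a - a'| * 2 ^ m ≤ 1 := not_lt.1 (Nat.find_min hex (m := m) (by omega))
    have hd : 0 < |a - a'| := by
      by_contra h
      have : |a - a'| = 0 := le_antisymm (not_lt.1 h) (abs_nonneg _)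
      rw [this] at hlt
      linarith
    refine suff m (by omega) hle ?_
    refine (volume_tube_inter_le (sub_ne_zero.1 (abs_pos.1 hd))).trans ?_
    rw [h2k, ← ENNReal.ofReal_mul (by positivity), ← ENNReal.ofReal_mul (by positivity)]
    refine ENNReal.ofReal_le_ofReal ?_
    rw [mul_div_assoc', div_le_iff₀ hd]
    have h3 : 0 ≤ |v - u| * δ ^ 2 * (2 ^ m * |a - a'|) := by positivity
    have h4 : 8 * δ ^ 2 * 1 ≤ 8 * δ ^ 2 * (|a - a'| * 2 ^ (m + 1)) := by gcongr
    rw [pow_succ (2 : ℝ)] at h4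
    linarith

/-! ### Compact sets containing many segments over a common interval -/

lemma sum_measure_singleton_mul_indicator_le (μ : Measure ℝ) (P : Finset ℝ) (A : Set ℝ) :
    ∑ x ∈ P, μ {x} * A.indicator 1 x ≤ μ A := by
  classical
  calc ∑ x ∈ P, μ {x} * A.indicator 1 x = ∑ x ∈ P with x ∈ A, μ {x} := by
        rw [Finset.sum_filter]
        refine Finset.sum_congr rfl fun x _ => ?_
        by_cases hx : x ∈ A <;> simp [hx]
    _ = μ (({x ∈ P | x ∈ A} : Finset ℝ) : Set ℝ) := sum_measure_singleton
    _ ≤ μ A := measure_mono fun x hx => (Finset.mem_filter.1 hx).2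

lemma sum_measure_singleton_eq_univ {μ : Measure ℝ} {P : Finset ℝ} (h : μ (P : Set ℝ)ᶜ = 0) :
    ∑ x ∈ P, μ {x} = μ Set.univ := by
  rw [sum_measure_singleton, ← measure_add_measure_compl P.measurableSet, h, add_zero]

/-- Intercepts of the lines of slope `a` whose part over `[u, v]` lies in `K`. -/
def intercepts (K : Set (ℝ × ℝ)) (u v a : ℝ) : Set ℝ :=
  {b | ∀ x ∈ Set.Icc u v, (x, a * x + b) ∈ K}

/-- The lower bound at scale `2 ^ (-n)`. The slopes carry a measure `μ` of dimension `t`, the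
intercepts of the lines of slope `a` a measure `ν a` of dimension `s` (with `p = 2 ^ (-t)`,
`q = 2 ^ (-s)`), and the geometric series with ratio `2 p q = 2 ^ (1 - s - t)` controls the
overlap of the tubes. -/
theorem le_volume_cthickening {K : Set (ℝ × ℝ)} {u v : ℝ} {X : ℕ}
    (huv : Set.Icc u v ⊆ Set.Icc (-(X : ℝ)) X) (n : ℕ) {p q c₁ c₂ : ℝ≥0∞} {m : ℤ} {m' : ℝ → ℤ}
    {μ : Measure ℝ} {P : Finset ℝ} (hP : (P : Set ℝ) ⊆ dyadicInterval 0 m)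
    (hPc : μ (P : Set ℝ)ᶜ = 0) (hc₁ : c₁ ≤ μ Set.univ)
    (hμ : ∀ k ≤ n, ∀ j, μ (dyadicInterval k j) ≤ p ^ k)
    {ν : ℝ → Measure ℝ} {Q : ℝ → Finset ℝ}
    (hQ : ∀ a ∈ P, (Q a : Set ℝ) ⊆ intercepts K u v a ∩ dyadicInterval 0 (m' a))
    (hQc : ∀ a ∈ P, ν a (Q a : Set ℝ)ᶜ = 0) (hc₂ : ∀ a ∈ P, c₂ ≤ ν a Set.univ)
    (hν : ∀ a ∈ P, ∀ k ≤ n, ∀ j, ν a (dyadicInterval k j) ≤ q ^ k) :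
    (c₁ * c₂ * (2 * ENNReal.ofReal (v - u))) ^ 2 ≤ volume (Metric.cthickening ((1 / 2) ^ n) K) *
      (ENNReal.ofReal (2 * |v - u| + 16) *
        ((2 * 1 + 1 : ℕ) * (2 * (X + 2) + 1 : ℕ) * (1 - 2 * p * q)⁻¹)) := by
  set δ : ℝ := (1 / 2) ^ n with hδ
  have hδ0 : 0 < δ := by positivity
  have htot : ∀ (ρ : Measure ℝ) (R : Finset ℝ) (i : ℤ) (r : ℝ≥0∞), ρ (R : Set ℝ)ᶜ = 0 →
      (R : Set ℝ) ⊆ dyadicInterval 0 i → ρ (dyadicInterval 0 i) ≤ r ^ 0 →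
      ∑ x ∈ R, ρ {x} ≤ 1 := by
    intro ρ R i r h1 h2 h3
    rw [sum_measure_singleton]
    simpa using (measure_mono h2).trans h3
  set w : (_ : ℝ) × ℝ → ℝ≥0∞ := fun i => μ {i.1} * ν i.1 {i.2} with hw
  set T : (_ : ℝ) × ℝ → Set (ℝ × ℝ) := fun i => tube u v δ i.1 i.2 with hT
  set S : Finset ((_ : ℝ) × ℝ) := P.sigma Q with hS
  have hw1 : c₁ * c₂ ≤ ∑ i ∈ S, w i := by
    rw [hS, Finset.sum_sigma]
    calc c₁ * c₂ ≤ (∑ a ∈ P, μ {a}) * c₂ := by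
          gcongr
          exact hc₁.trans (sum_measure_singleton_eq_univ hPc).ge
      _ = ∑ a ∈ P, μ {a} * c₂ := Finset.sum_mul _ _ _
      _ ≤ _ := by
          refine Finset.sum_le_sum fun a ha => ?_
          simp only [hw]
          rw [← Finset.mul_sum, sum_measure_singleton_eq_univ (hQc a ha)]
          gcongr
          exact hc₂ a ha
  have hw2 : ∑ i ∈ S, w i ≤ 1 := by
    rw [hS, Finset.sum_sigma]
    refine le_trans (Finset.sum_le_sum fun a ha => ?_)
      (htot μ P m p hPc hP (hμ 0 (Nat.zero_le _) _))
    simp only [hw]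
    rw [← Finset.mul_sum]
    exact mul_le_of_le_one_right' (htot (ν a) (Q a) (m' a) q (hQc a ha)
      ((hQ a ha).trans Set.inter_subset_right) (hν a ha 0 (Nat.zero_le _) _))
  set G : ℝ≥0∞ := ENNReal.ofReal ((2 * |v - u| + 16) * δ ^ 2) with hG
  set C : ℝ≥0∞ := (2 * 1 + 1 : ℕ) * (2 * (X + 2) + 1 : ℕ) * (1 - 2 * p * q)⁻¹ with hC
  have hinner : ∀ i ∈ S, ∑ j ∈ S, w j * volume (T i ∩ T j) ≤ G * C := by
    intro i hi
    obtain ⟨a, b⟩ := i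
    have ha : a ∈ P := (Finset.mem_sigma.1 hi).1
    set A : ℕ → Set ℝ := fun k => {z : ℝ | |a - z| * 2 ^ k ≤ (1 : ℕ)} with hA
    set B : ℕ → Set ℝ := fun k => {z : ℝ | |b - z| * 2 ^ k ≤ (X + 2 : ℕ)} with hB
    have hterm : ∀ j ∈ S, w j * volume (T ⟨a, b⟩ ∩ T j) ≤
        ∑ k ∈ Finset.range (n + 1), G * 2 ^ k *
          ((μ {j.1} * (A k).indicator 1 j.1) * (ν j.1 {j.2} * (B k).indicator 1 j.2)) := by
      intro j hj
      have hj1 : j.1 ∈ P := (Finset.mem_sigma.1 hj).1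
      have haa : |a - j.1| ≤ 1 := by
        have h1 := (hP ha : ⌊(2 : ℝ) ^ 0 * a⌋ = m)
        have h2 := (hP hj1 : ⌊(2 : ℝ) ^ 0 * j.1⌋ = m)
        have := Int.abs_sub_lt_one_of_floor_eq_floor (h1.trans h2.symm)
        rw [pow_zero, one_mul, one_mul] at this
        exact this.le
      refine (mul_le_mul_right (volume_tube_inter_le_sum huv n haa b j.2) (w j)).trans ?_
      rw [Finset.mul_sum]
      refine Finset.sum_le_sum fun k _ => le_of_eq ?_
      rw [hw]
      ring
    calc ∑ j ∈ S, w j * volume (T ⟨a, b⟩ ∩ T j)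
        ≤ ∑ j ∈ S, ∑ k ∈ Finset.range (n + 1), G * 2 ^ k *
          ((μ {j.1} * (A k).indicator 1 j.1) * (ν j.1 {j.2} * (B k).indicator 1 j.2)) :=
          Finset.sum_le_sum hterm
      _ = ∑ k ∈ Finset.range (n + 1), G * 2 ^ k * ∑ a' ∈ P, (μ {a'} * (A k).indicator 1 a') *
            ∑ b' ∈ Q a', ν a' {b'} * (B k).indicator 1 b' := by
          rw [Finset.sum_comm]
          refine Finset.sum_congr rfl fun k _ => ?_
          rw [← Finset.mul_sum, hS, Finset.sum_sigma]
          simp only [Finset.mul_sum]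
      _ ≤ ∑ k ∈ Finset.range (n + 1), G * 2 ^ k * (((2 * 1 + 1 : ℕ) * p ^ k) *
            ((2 * (X + 2) + 1 : ℕ) * q ^ k)) := by
          refine Finset.sum_le_sum fun k hk => ?_
          have hkn : k ≤ n := Nat.lt_succ_iff.1 (Finset.mem_range.1 hk)
          gcongr
          calc ∑ a' ∈ P, (μ {a'} * (A k).indicator 1 a') *
                ∑ b' ∈ Q a', ν a' {b'} * (B k).indicator 1 b'
              ≤ ∑ a' ∈ P, (μ {a'} * (A k).indicator 1 a') *
                ((2 * (X + 2) + 1 : ℕ) * q ^ k) := by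
                refine Finset.sum_le_sum fun a' ha' => ?_
                gcongr
                exact (sum_measure_singleton_mul_indicator_le _ _ _).trans
                  (measure_setOf_abs_sub_le (hν a' ha' k hkn) b (X + 2))
            _ ≤ _ := by
                rw [← Finset.sum_mul]
                gcongr
                exact (sum_measure_singleton_mul_indicator_le _ _ _).trans
                  (measure_setOf_abs_sub_le (hμ k hkn) a 1)
      _ = G * ((2 * 1 + 1 : ℕ) * (2 * (X + 2) + 1 : ℕ) *
            ∑ k ∈ Finset.range (n + 1), (2 * p * q) ^ k) := by
          rw [Finset.mul_sum, Finset.mul_sum]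
          refine Finset.sum_congr rfl fun k _ => ?_
          rw [mul_pow, mul_pow]
          ring
      _ ≤ G * C := by
          rw [hC, ← ENNReal.tsum_geometric]
          gcongr
          exact ENNReal.sum_le_tsum _
  have hTU : ∀ i ∈ S, T i ⊆ Metric.cthickening δ K := fun i hi =>
    tube_subset_cthickening (hQ i.1 (Finset.mem_sigma.1 hi).1 (Finset.mem_sigma.1 hi).2).1
  have hmain := sq_sum_measure_le volume S w T (fun i => measurableSet_tube _ _ _ _ _)
    Metric.isClosed_cthickening.measurableSet hTU
  have hδ' : ENNReal.ofReal δ ^ 2 ≠ 0 := by simp [hδ0]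
  have hδ'' : ENNReal.ofReal δ ^ 2 ≠ ⊤ := by simp
  refine (ENNReal.mul_le_mul_iff_right hδ' hδ'').1 ?_
  calc ENNReal.ofReal δ ^ 2 * (c₁ * c₂ * (2 * ENNReal.ofReal (v - u))) ^ 2
      = (c₁ * c₂ * (ENNReal.ofReal (2 * δ) * ENNReal.ofReal (v - u))) ^ 2 := by
        rw [ENNReal.ofReal_mul (by norm_num), ENNReal.ofReal_ofNat]
        ring
    _ ≤ (∑ i ∈ S, w i * volume (T i)) ^ 2 := by
        simp only [hT, volume_tube]
        rw [← Finset.sum_mul]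
        gcongr
    _ ≤ volume (Metric.cthickening δ K) * (1 * (G * C)) := by
        refine hmain.trans ?_
        gcongr
        refine (Finset.sum_le_sum fun i hi => mul_le_mul_right (hinner i hi) (w i)).trans ?_
        rw [← Finset.sum_mul]
        gcongr
    _ = _ := by
        rw [hG, ENNReal.ofReal_mul (by positivity), ENNReal.ofReal_pow hδ0.le]
        ring

lemma two_mul_half_rpow_mul_lt_one {s t : ℝ} (h : 1 < t + s) :
    2 * (1 / 2 : ℝ≥0∞) ^ t * (1 / 2 : ℝ≥0∞) ^ s < 1 := by
  rw [mul_assoc, ← ENNReal.rpow_add _ _ (by simp) (by simp)]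
  have h1 : (1 / 2 : ℝ≥0∞) ^ (t + s) < (1 / 2) ^ (1 : ℝ) :=
    ENNReal.rpow_lt_rpow_of_exponent_gt (by simp) (by simp) h
  rw [ENNReal.rpow_one] at h1
  calc 2 * (1 / 2 : ℝ≥0∞) ^ (t + s) < 2 * (1 / 2) := by
        rw [ENNReal.mul_lt_mul_iff_right (by simp) (by simp)]
        exact h1
    _ = 1 := by
        rw [one_div]
        exact ENNReal.mul_inv_cancel (by simp) (by simp)

/-- The planar statement in slope-intercept coordinates, once the segments all lie over one interval
`[u, v]`, the slopes lie in one unit interval, and the content of the intercepts is bounded below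
uniformly. -/
theorem volume_pos_of_lt_hausdorffContent {K : Set (ℝ × ℝ)} (hK : IsCompact K) {s t : ℝ}
    (hs : 0 < s) (ht : 0 < t) (hst : 1 < t + s) {u v : ℝ} (huv : u < v) {m m' : ℤ} {c : ℝ≥0∞}
    (hc : 0 < c) {A : Set ℝ} (hA : A ⊆ dyadicInterval 0 m)
    (hAt : 0 < Measure.hausdorffMeasure t A)
    (hAc : ∀ a ∈ A, c < hausdorffContent s hs (intercepts K u v a ∩ dyadicInterval 0 m')) :
    0 < volume K := by
  obtain ⟨X, hX⟩ := exists_nat_ge (max |u| |v|)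
  have hu := abs_le.1 ((le_max_left _ _).trans hX)
  have hv := abs_le.1 ((le_max_right _ _).trans hX)
  have hX' : Set.Icc u v ⊆ Set.Icc (-(X : ℝ)) X := Set.Icc_subset_Icc hu.1 hv.2
  have hfin : ∀ r : ℝ, 0 < r → ∀ k : ℕ, ((1 / 2 : ℝ≥0∞) ^ r) ^ k ≠ ⊤ := fun r hr k =>
    ENNReal.pow_ne_top (ENNReal.rpow_ne_top_of_nonneg hr.le (by simp))
  set c₁ := hausdorffContent t ht A
  have hc₁ : 0 < c₁ := hausdorffContent_pos ht hAt
  set p : ℝ≥0∞ := (1 / 2) ^ t with hp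
  set q : ℝ≥0∞ := (1 / 2) ^ s with hq
  set C : ℝ≥0∞ := ENNReal.ofReal (2 * |v - u| + 16) *
        ((2 * 1 + 1 : ℕ) * (2 * (X + 2) + 1 : ℕ) * (1 - 2 * p * q)⁻¹) with hC
  have hCtop : C ≠ ⊤ := by
    have h1 : (1 - 2 * p * q)⁻¹ ≠ ⊤ :=
      ENNReal.inv_ne_top.2 (tsub_pos_of_lt (two_mul_half_rpow_mul_lt_one hst)).ne'
    exact ENNReal.mul_ne_top ENNReal.ofReal_ne_top (ENNReal.mul_ne_top
      (ENNReal.mul_ne_top (ENNReal.natCast_ne_top _) (ENNReal.natCast_ne_top _)) h1)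
  have hlow : ∀ n : ℕ, (c₁ * c * (2 * ENNReal.ofReal (v - u))) ^ 2 ≤
      volume (Metric.cthickening ((1 / 2) ^ n) K) * C := by
    intro n
    obtain ⟨μ, P, hP, hPc, hPm, hPb⟩ := exists_discrete_frostman_measure (hausdorffContent t ht)
      (fun k => p ^ k) (hausdorffContent_dyadicInterval_le ht) (hfin t ht) A n 0 m
    have hfrost := fun a => exists_discrete_frostman_measure (hausdorffContent s hs)
      (fun k => q ^ k) (hausdorffContent_dyadicInterval_le hs) (hfin s hs)
      (intercepts K u v a) n 0 m'
    choose ν Q hQ hQc hQm hQb using hfrost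
    rw [Set.inter_eq_left.2 hA] at hP hPm
    exact le_volume_cthickening (m' := fun _ => m') hX' n (hP.trans hA) hPc hPm
      (fun k hk j => hPb k (Nat.zero_le _) (by omega) j) (fun a _ => hQ a) (fun a _ => hQc a)
      (fun a ha => (hAc a (hP ha)).le.trans (hQm a))
      (fun a _ k hk j => hQb a k (Nat.zero_le _) (by omega) j)
  have hlim : Filter.Tendsto (fun n : ℕ => volume (Metric.cthickening ((1 / 2 : ℝ) ^ n) K) * C)
      Filter.atTop (𝓝 (volume K * C)) :=
    ENNReal.Tendsto.mul_const ((tendsto_measure_cthickening_of_isCompact hK).comp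
      (tendsto_pow_atTop_nhds_zero_of_lt_one (by norm_num) (by norm_num))) (Or.inr hCtop)
  have hge := ge_of_tendsto' hlim hlow
  have hpos : 0 < (c₁ * c * (2 * ENNReal.ofReal (v - u))) ^ 2 := by
    refine pos_of_ne_zero (pow_ne_zero 2 (ne_of_gt ?_))
    have h1 : 0 < ENNReal.ofReal (v - u) := ENNReal.ofReal_pos.2 (by linarith)
    exact ENNReal.mul_pos (ENNReal.mul_pos hc₁.ne' hc.ne').ne'
      (ENNReal.mul_pos (by simp) h1.ne').ne'
  exact pos_of_ne_zero fun h0 => (hpos.trans_le hge).ne' (by rw [h0, zero_mul])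

/-- The planar statement in slope-intercept coordinates. Countable stability of Hausdorff dimension
and of null sets makes the interval, the unit intervals of slopes and intercepts, and the lower bound
on the content uniform; the choice is made separately for each slope, so no measurable dependence on
the slope is involved. -/
theorem volume_pos_of_lt_dimH_slopes {K : Set (ℝ × ℝ)} (hK : IsCompact K) {s : ℝ} (hs : 0 < s)
    (hs1 : s ≤ 1) {A : Set ℝ} (hdim : ENNReal.ofReal (1 - s) < dimH A)
    (hA : ∀ a ∈ A, 0 < Measure.hausdorffMeasure s {b | ∃ u v : ℝ, u < v ∧ b ∈ intercepts K u v a}) :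
    0 < volume K := by
  set F : ((ℚ × ℚ) × (ℤ × ℤ)) × ℕ → Set ℝ := fun i =>
    {a | a ∈ dyadicInterval 0 i.1.2.1 ∧ (i.1.1.1 : ℝ) < i.1.1.2 ∧
      (i.2 : ℝ≥0∞)⁻¹ < hausdorffContent s hs
        (intercepts K i.1.1.1 i.1.1.2 a ∩ dyadicInterval 0 i.1.2.2)} with hF
  have hcover : A ⊆ ⋃ i, F i := by
    intro a ha
    have hpos := hausdorffContent_pos hs (hA a ha)
    have hsub : {b | ∃ u v : ℝ, u < v ∧ b ∈ intercepts K u v a} ⊆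
        ⋃ i : {r : ℚ × ℚ // r.1 < r.2} × ℤ,
          intercepts K i.1.1.1 i.1.1.2 a ∩ dyadicInterval 0 i.2 := by
      rintro b ⟨u, v, huv, hb⟩
      obtain ⟨r₁, h1, h2⟩ := exists_rat_btwn huv
      obtain ⟨r₂, h3, h4⟩ := exists_rat_btwn h2
      refine Set.mem_iUnion.2 ⟨⟨⟨(r₁, r₂), by exact_mod_cast h3⟩, ⌊(2 : ℝ) ^ 0 * b⌋⟩, ?_, rfl⟩
      exact fun x hx => hb x ⟨h1.le.trans hx.1, hx.2.trans h4.le⟩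
    have hne : hausdorffContent s hs (⋃ i : {r : ℚ × ℚ // r.1 < r.2} × ℤ,
          intercepts K i.1.1.1 i.1.1.2 a ∩ dyadicInterval 0 i.2) ≠ 0 :=
      (hpos.trans_le (measure_mono hsub)).ne'
    rw [Ne, measure_iUnion_null_iff, not_forall] at hne
    obtain ⟨⟨⟨r, hr⟩, j⟩, hi⟩ := hne
    obtain ⟨k, hk⟩ := ENNReal.exists_inv_nat_lt hi
    exact Set.mem_iUnion.2 ⟨((r, (⌊(2 : ℝ) ^ 0 * a⌋, j)), k), rfl, by exact_mod_cast hr, hk⟩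
  have hlt := hdim.trans_le (dimH_mono hcover)
  rw [dimH_iUnion] at hlt
  obtain ⟨i, hi⟩ := lt_iSup_iff.1 hlt
  obtain ⟨t, ht1, ht2⟩ := ENNReal.lt_iff_exists_nnreal_btwn.1 hi
  have ht1' : 1 - s < t := by
    rw [← ENNReal.ofReal_coe_nnreal] at ht1
    exact (ENNReal.ofReal_lt_ofReal_iff_of_nonneg (by linarith)).1 ht1
  have htop : Measure.hausdorffMeasure (t : ℝ) (F i) = ⊤ := hausdorffMeasure_of_lt_dimH ht2
  obtain ⟨a, ha⟩ : (F i).Nonempty := by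
    by_contra h
    rw [Set.not_nonempty_iff_eq_empty.1 h] at htop
    simp at htop
  exact volume_pos_of_lt_hausdorffContent hK hs (t := t) (by linarith) (by linarith) ha.2.1
    (c := (i.2 : ℝ≥0∞)⁻¹) (by simp) (fun a ha => ha.1) (htop ▸ ENNReal.zero_lt_top)
    (fun a ha => ha.2.2)

/-! ### Slope-intercept coordinates -/

lemma lineProj_eq (e x : EuclideanSpace ℝ (Fin 2)) : lineProj e x = x 0 * e 0 + x 1 * e 1 := by
  simp [lineProj, PiLp.inner_apply, Fin.sum_univ_two, mul_comm]

/-- A compact set of `EuclideanSpace ℝ (Fin 2)` seen in `ℝ × ℝ`. -/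
def toProd (K : Set (EuclideanSpace ℝ (Fin 2))) : Set (ℝ × ℝ) := {p | !₂[p.1, p.2] ∈ K}

lemma toProd_eq_image (K : Set (EuclideanSpace ℝ (Fin 2))) :
    toProd K = (fun x : EuclideanSpace ℝ (Fin 2) => (x 0, x 1)) '' K := by
  ext ⟨x, y⟩
  constructor
  · intro h
    exact ⟨_, h, by simp⟩
  · rintro ⟨z, hz, h⟩
    obtain ⟨rfl, rfl⟩ := Prod.mk.inj h
    have : !₂[z 0, z 1] = z := by
      ext i
      fin_cases i <;> rfl
    change !₂[z 0, z 1] ∈ K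
    rwa [this]

lemma IsCompact.toProd {K : Set (EuclideanSpace ℝ (Fin 2))} (hK : IsCompact K) :
    IsCompact (toProd K) := by
  rw [toProd_eq_image]
  exact hK.image (by fun_prop)

lemma volume_toProd {K : Set (EuclideanSpace ℝ (Fin 2))} (hK : MeasurableSet K) :
    volume (toProd K) = volume K := by
  have h := (PiLp.volume_preserving_toLp (Fin 2)).comp
    ((volume_preserving_finTwoArrow ℝ).symm MeasurableEquiv.finTwoArrow)
  rw [← h.measure_preimage hK.nullMeasurableSet]
  rfl

/-- The unit normal `(-a, 1) / √(1 + a ^ 2)` of the lines of slope `a`. -/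
noncomputable def unitNormal (a : ℝ) : EuclideanSpace ℝ (Fin 2) := (√(1 + a ^ 2))⁻¹ • !₂[-a, 1]

lemma contDiff_unitNormal : ContDiff ℝ 1 unitNormal := by
  have h1 : ContDiff ℝ 1 fun a : ℝ => (√(1 + a ^ 2))⁻¹ := by
    refine ContDiff.inv (ContDiff.sqrt (by fun_prop) fun a => by positivity) fun a => ?_
    have : 0 < √(1 + a ^ 2) := Real.sqrt_pos.2 (by positivity)
    exact this.ne'
  refine h1.smul (contDiff_euclidean.2 fun i => ?_)
  fin_cases i
  · exact contDiff_neg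
  · exact contDiff_const

lemma eq_unitNormal_or_eq_neg {e : EuclideanSpace ℝ (Fin 2)} (he : ‖e‖ = 1) (h1 : e 1 ≠ 0) :
    e = unitNormal (-(e 0) / e 1) ∨ e = -unitNormal (-(e 0) / e 1) := by
  have hn : e 0 ^ 2 + e 1 ^ 2 = 1 := by
    have := EuclideanSpace.real_norm_sq_eq e
    rw [he, Fin.sum_univ_two] at this
    linarith
  have hs : 1 + (-(e 0) / e 1) ^ 2 = (e 1)⁻¹ ^ 2 := by
    field_simp
    linarith
  have hsq : (√(1 + (-(e 0) / e 1) ^ 2))⁻¹ = |e 1| := by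
    rw [hs, Real.sqrt_sq_eq_abs, abs_inv, inv_inv]
  rcases h1.lt_or_gt with h | h
  · right
    rw [unitNormal, hsq, abs_of_neg h]
    ext i
    fin_cases i
    · simp
      field_simp
    · simp
  · left
    rw [unitNormal, hsq, abs_of_pos h]
    ext i
    fin_cases i
    · simp
      field_simp
    · simp

/-- A non-degenerate segment in `K`, contained in the line `x · e = t`, lies over a non-degenerate
interval of the first axis if `e` is not horizontal. -/
lemma exists_mem_intercepts {K : Set (EuclideanSpace ℝ (Fin 2))} {e x : EuclideanSpace ℝ (Fin 2)}
    (h1 : e 1 ≠ 0) {ℓ : Set (EuclideanSpace ℝ (Fin 2))} (hℓ : IsPerpSegment e ℓ) (hℓK : ℓ ⊆ K)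
    (hx : x ∈ ℓ) :
    ∃ u v : ℝ, u < v ∧ lineProj e x / e 1 ∈ intercepts (toProd K) u v (-(e 0) / e 1) := by
  obtain ⟨p, q, hpq, horth, rfl⟩ := hℓ
  have horth' : (q 0 - p 0) * e 0 + (q 1 - p 1) * e 1 = 0 := by
    have : lineProj e (q - p) = 0 := horth
    rw [lineProj_eq] at this
    simpa using this
  have h0 : p 0 ≠ q 0 := by
    intro h
    rw [h, sub_self, zero_mul, zero_add] at horth'
    have h' : q 1 - p 1 = 0 := (mul_eq_zero.1 horth').resolve_right h1
    refine hpq ?_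
    ext i
    fin_cases i
    · exact h
    · exact (sub_eq_zero.1 h').symm
  have hproj : lineProj e x = lineProj e p := by
    rw [segment_eq_image'] at hx
    obtain ⟨θ, -, rfl⟩ := hx
    simp only [lineProj_eq, PiLp.add_apply, PiLp.smul_apply, PiLp.sub_apply, smul_eq_mul]
    linear_combination θ * horth'
  have hmem : ∀ z : ℝ, (z - p 0) / (q 0 - p 0) ∈ Set.Icc (0 : ℝ) 1 →
      (z, -(e 0) / e 1 * z + lineProj e x / e 1) ∈ toProd K := by
    intro z hz
    refine hℓK ?_
    rw [segment_eq_image']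
    refine ⟨_, hz, ?_⟩
    have hd : q 0 - p 0 ≠ 0 := sub_ne_zero.2 h0.symm
    have h3 : q 1 - p 1 = -(q 0 - p 0) * e 0 / e 1 := by
      rw [eq_div_iff h1]
      linarith
    ext i
    fin_cases i
    · simp
      field_simp
      ring
    · simp only [hproj, lineProj_eq, PiLp.add_apply, PiLp.smul_apply, PiLp.sub_apply, smul_eq_mul,
        Fin.mk_one, h3]
      simp
      field_simp
      ring
  rcases h0.lt_or_gt with h | h
  · refine ⟨p 0, q 0, h, fun z hz => hmem z ⟨?_, ?_⟩⟩
    · exact div_nonneg (by linarith [hz.1]) (by linarith)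
    · exact (div_le_one (by linarith)).2 (by linarith [hz.2])
  · refine ⟨q 0, p 0, h, fun z hz => hmem z ⟨?_, ?_⟩⟩
    · exact div_nonneg_of_nonpos (by linarith [hz.2]) (by linarith)
    · exact (div_le_one_of_neg (by linarith)).2 (by linarith [hz.1])

theorem theorem2 (s : ℝ) (hs0 : 0 < s) (hs1 : s ≤ 1)
    (K : Set (EuclideanSpace ℝ (Fin 2))) (hK : IsCompact K)
    (E₀ : Set (EuclideanSpace ℝ (Fin 2)))
    (hE₀ : E₀ ⊆ Metric.sphere (0 : EuclideanSpace ℝ (Fin 2)) 1)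
    (hdim : ENNReal.ofReal (1 - s) < dimH E₀)
    (hF : ∀ e ∈ E₀, ∃ F : Set (Set (EuclideanSpace ℝ (Fin 2))),
      IsDimFamily s e F ∧ ⋃₀ F ⊆ K) :
    0 < volume K := by
  set A : Set ℝ := {a | 0 < Measure.hausdorffMeasure s
    {b | ∃ u v : ℝ, u < v ∧ b ∈ intercepts (toProd K) u v a}} with hA
  rw [← volume_toProd hK.measurableSet]
  refine volume_pos_of_lt_dimH_slopes hK.toProd hs0 hs1 (A := A) (hdim.trans_le ?_) fun a ha => ha
  have hslope : ∀ e ∈ E₀, e 1 ≠ 0 → -(e 0) / e 1 ∈ A := by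
    intro e he h1
    obtain ⟨F, ⟨hperp, hpos⟩, hFK⟩ := hF e he
    set c : ℝ := e 1
    have hsub : lineProj e '' ⋃₀ F ⊆
        c • {b | ∃ u v : ℝ, u < v ∧ b ∈ intercepts (toProd K) u v (-(e 0) / c)} := by
      rintro _ ⟨x, ⟨ℓ, hℓ, hx⟩, rfl⟩
      refine Set.mem_smul_set.2 ⟨lineProj e x / c, exists_mem_intercepts h1 (hperp ℓ hℓ)
        ((Set.subset_sUnion_of_mem hℓ).trans hFK) hx, ?_⟩
      rw [smul_eq_mul, mul_div_cancel₀ _ h1]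
    have h2 := hpos.trans_le (measure_mono hsub)
    rw [Measure.hausdorffMeasure_smul₀ hs0.le h1] at h2
    change 0 < Measure.hausdorffMeasure s _
    refine pos_of_ne_zero fun h0 => h2.ne' ?_
    rw [h0, smul_zero]
  have hcover : E₀ ⊆ (unitNormal '' A ∪ (fun a => -unitNormal a) '' A) ∪
      {!₂[1, 0], !₂[-1, 0]} := by
    intro e he
    have hnorm : ‖e‖ = 1 := by simpa using hE₀ he
    by_cases h1 : e 1 = 0
    · right
      have hn := EuclideanSpace.real_norm_sq_eq e
      rw [hnorm, Fin.sum_univ_two, h1] at hn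
      have h0 : e 0 = 1 ∨ e 0 = -1 := sq_eq_sq_iff_eq_or_eq_neg.1 (by linarith)
      rcases h0 with h0 | h0
      · left
        ext i
        fin_cases i
        · exact h0
        · exact h1
      · right
        ext i
        fin_cases i
        · exact h0
        · exact h1
    · left
      rcases eq_unitNormal_or_eq_neg hnorm h1 with h | h
      · exact Or.inl ⟨_, hslope e he h1, h.symm⟩
      · exact Or.inr ⟨_, hslope e he h1, h.symm⟩
  refine (dimH_mono hcover).trans ?_
  rw [dimH_union, dimH_union]
  refine max_le (max_le ?_ ?_) ((dimH_finite (Set.toFinite _)).trans_le bot_le)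
  · exact contDiff_unitNormal.contDiffOn.dimH_image_le convex_univ (Set.subset_univ A)
  · exact contDiff_unitNormal.neg.contDiffOn.dimH_image_le convex_univ (Set.subset_univ A)
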